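/- **Conventions.** For metric spaces $X,Y$ write $X\hookrightarrow Y$ if there is an isometric embedding of $X$ in $Y$, $X\simeq Y$ if there is a surjective one, and $X\subseteq Y$ if $X$ is a subset of $Y$ with the metric induced from $Y$. Let $\mathfrak N,\mathfrak A,\mathfrak B$ be classes of metric spaces. * A metric space $Y$ is *$\mathfrak N$-universal* if $X\hookrightarrow Y$ for every $X\in\mathfrak N$. It is *minimal $\mathfrak N$-universal* if moreover every $\mathfrak N$-universal subspace $Y_0\subseteq Y$ equals $Y$. * $\mathfrak N\hookrightarrow\mathfrak A$ means that for every $X\in\mathfrak N$ there is $Y\in\mathfrak A$ with $X\hookrightarrow Y$; $\mathfrak A\preceq\mathfrak B$ means that for every $X\in\mathfrak A$ there is $Y\in\mathfrak B$ with $X\subseteq Y$. The class $\mathfrak A$ is *minimal $\mathfrak N$-universal* if (i) $\mathfrak N\hookrightarrow\mathfrak A$; (ii) for every class $\mathfrak B$ of metric spaces, $\mathfrak N\hookrightarrow\mathfrak B$ and $\mathfrak B\preceq\mathfrak A$ imply $\mathfrak A\preceq\mathfrak B$; (iii) for distinct $X,Y\in\mathfrak A$, neither $X\hookrightarrow Y$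 nor $Y\hookrightarrow X$. * A metric space $X$ is a *disjoint union* of metric spaces $Y_i$, $i\in I$, if $X$ has a partition into non-empty, pairwise disjoint subsets $X_i$, $i\in I$, such that $X_i$, with the metric induced from $X$, satisfies $X_i\simeq Y_i$ for every $i\in I$. **Statement.** Let $n$ be a positive integer and let $\mathcal N_n$ be the class of all metric spaces whose metric is induced by the norm of some structure of an $n$-dimensional real normed linear space on the set of their points. Then there is a system of representatives $\mathfrak M\subseteq\mathcal N_n$ of the isometry classes of members of $\mathcal N_n$ (a class containing exactly one member of each isometry class). Every such $\mathfrak M$ is a set, it is a minimal $\mathcal N_n$-universal class of metric spaces, and some disjoint union $$X=\coprod_{Y\in\mathfrak M}Y$$ of the members of $\mathfrak M$ is a minimal $\mathcal N_n$-universal metric space. -/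

import Mathlib

universe u

/-- A metric space in the set-theoretic sense: a set together with a metric on its points.
Working with sets of the cumulative hierarchy gives inclusions `X ⊆ Y` and equalities `X = Y` of
metric spaces their literal meaning. -/
structure MetSp : Type (u + 1) where
  /-- The support of the space. -/
  carrier : ZFSet.{u}
  /-- The metric on the support. -/
  metric : MetricSpace {x : ZFSet.{u} // x ∈ carrier}

namespace MetSp

/-- The type of points of a metric space. -/
def Point (X : MetSp.{u}) : Type (u + 1) := {x : ZFSet.{u} // x ∈ X.carrier}

instance instMetricSpacePoint (X : MetSp.{u}) : MetricSpace X.Point := X.metric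

/-- `X ↪ Y`: there is an isometric embedding of `X` in `Y`. -/
def Embeds (X Y : MetSp.{u}) : Prop := ∃ f : X.Point → Y.Point, Isometry f

/-- `X ≃ Y`: there is a surjective isometric embedding of `X` in `Y`. -/
def Isometric (X Y : MetSp.{u}) : Prop :=
  ∃ f : X.Point → Y.Point, Isometry f ∧ Function.Surjective f

/-- `X ⊆ Y`: the support of `X` is a subset of that of `Y`, and the metric of `X` is the one
induced from `Y`. -/
def IsSubspace (X Y : MetSp.{u}) : Prop :=
  ∃ h : ∀ z : ZFSet.{u}, z ∈ X.carrier → z ∈ Y.carrier,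
    ∀ (x y : ZFSet.{u}) (hx : x ∈ X.carrier) (hy : y ∈ X.carrier),
      Y.metric.dist ⟨x, h x hx⟩ ⟨y, h y hy⟩ = X.metric.dist ⟨x, hx⟩ ⟨y, hy⟩

/-- `X` and `Y` are comparable if one of them embeds in the other. -/
def Comparable (X Y : MetSp.{u}) : Prop := Embeds X Y ∨ Embeds Y X

/-- The metric space `Y` is universal for the class `M`. -/
def IsUniversal (M : Set MetSp.{u}) (Y : MetSp.{u}) : Prop := ∀ X ∈ M, Embeds X Y

/-- The metric space `Y` is minimal `M`-universal: it is `M`-universal, and no subspace of `Y`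
other than `Y` itself is. -/
def IsMinimalUniversal (M : Set MetSp.{u}) (Y : MetSp.{u}) : Prop :=
  IsUniversal M Y ∧ ∀ Y₀ : MetSp.{u}, IsSubspace Y₀ Y → IsUniversal M Y₀ → Y₀ = Y

/-- The class `A` is universal for the class `M`, written `M ↪ A`. -/
def IsUniversalClass (M A : Set MetSp.{u}) : Prop := ∀ X ∈ M, ∃ Y ∈ A, Embeds X Y

/-- `M ≼ B`: every member of `M` is a subspace of a member of `B`. -/
def Precedes (M B : Set MetSp.{u}) : Prop := ∀ X ∈ M, ∃ Y ∈ B, IsSubspace X Y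

/-- The class `A` is minimal `M`-universal. -/
structure IsMinimalUniversalClass (M A : Set MetSp.{u}) : Prop where
  universal : IsUniversalClass M A
  minimal : ∀ B : Set MetSp.{u}, IsUniversalClass M B → Precedes B A → Precedes A B
  incomparable : ∀ X ∈ A, ∀ Y ∈ A, X ≠ Y → ¬ Comparable X Y

/-- `X` is a disjoint union of the spaces `Y i`: there is a partition of `X` into non-empty
pairwise disjoint subsets `P i`, which with the metrics induced from `X` are isometric to `Y i`. -/
def IsDisjointUnion (X : MetSp.{u}) {ι : Type (u + 1)} (Y : ι → MetSp.{u}) : Prop :=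
  ∃ P : ι → Set X.Point,
    (∀ i, (P i).Nonempty) ∧
    (∀ i j, i ≠ j → Disjoint (P i) (P j)) ∧
    (⋃ i, P i) = Set.univ ∧
    ∀ i, Nonempty (P i ≃ᵢ (Y i).Point)

/-- The class of `n`-dimensional real normed spaces, as metric spaces: the metric is induced by a
norm for some structure of an `n`-dimensional real vector space on the set of points. -/
def normedSpaces (n : ℕ) : Set MetSp.{u} :=
  {X | ∃ (_ : NormedAddCommGroup X.Point) (_ : NormedSpace ℝ X.Point),
    (∀ x y : X.Point, X.metric.dist x y = ‖x - y‖) ∧ Module.rank ℝ X.Point = n}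

/-- `A` is a system of representatives of the isometry classes of members of `M`. -/
def IsRepresentativeSystem (M A : Set MetSp.{u}) : Prop :=
  A ⊆ M ∧ ∀ X ∈ M, ∃! Y, Y ∈ A ∧ Isometric X Y

end MetSp

/-! Everything rests on rigidity: a distance preserving map between normed spaces of equal finite
dimension is onto (`Isometry.surjective_of_finrank_eq`). By Rademacher it is differentiable
somewhere, and its derivative there is a linear isometry, bijective by dimension. Undoing it leaves
an isometric self-map, which after a translation fixes 0, preserves closed balls, and is onto by
compactness. Hence distinct representatives are incomparable. Placed at mutual distance at least
one, they form a minimal universal space: a connected copy of a representative lies in one summand,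
necessarily its own, and fills it. -/

/-- An isometric self-embedding of a compact metric space is surjective. -/
theorem Isometry.surjective_of_compactSpace {α : Type*} [MetricSpace α] [CompactSpace α]
    {f : α → α} (hf : Isometry f) : Function.Surjective f := by
  intro a
  by_contra ha
  have hcl : IsClosed (Set.range f) := (isCompact_range hf.continuous).isClosed
  obtain ⟨ε, hε, hball⟩ := Metric.isOpen_iff.1 hcl.isOpen_compl a ha
  -- Cancelling `f^[m]` leaves the distance from `a` to a point of the range, so the orbit of `a`
  -- has no Cauchy subsequence.
  have hsep : ∀ m n : ℕ, m < n → ε ≤ dist (f^[m] a) (f^[n] a) := by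
    intro m n hmn
    obtain ⟨k, rfl⟩ := Nat.exists_eq_add_of_lt hmn
    have hit : ∀ j : ℕ, Isometry f^[j] := by
      intro j
      induction j with
      | zero => exact isometry_id
      | succ j ih => exact ih.comp hf
    rw [add_assoc, Function.iterate_add_apply, (hit m).dist_eq, Function.iterate_succ_apply']
    by_contra hlt
    exact hball (Metric.mem_ball'.2 (not_le.1 hlt)) ⟨_, rfl⟩
  obtain ⟨b, φ, hφ, hb⟩ := CompactSpace.tendsto_subseq (fun j => f^[j] a)
  have hc := hb.cauchySeq
  obtain ⟨N, hN⟩ := Metric.cauchySeq_iff.1 hc ε hε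
  exact absurd (hN N le_rfl (N + 1) (Nat.le_succ N))
    (not_lt.2 (hsep _ _ (hφ (Nat.lt_succ_self N))))

/-- An isometric self-embedding of a proper metric space with a fixed point is surjective. -/
theorem Isometry.surjective_of_fixedPoint {α : Type*} [MetricSpace α] [ProperSpace α]
    {f : α → α} (hf : Isometry f) {p : α} (hp : f p = p) : Function.Surjective f := by
  intro a
  let g : Metric.closedBall p (dist a p) → Metric.closedBall p (dist a p) := fun x =>
    ⟨f x, by
      have := hf.dist_eq x p
      rw [hp] at this
      rw [Metric.mem_closedBall, this]
      exact x.2⟩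
  have hg : Isometry g := Isometry.of_dist_eq fun x y => hf.dist_eq x y
  have : CompactSpace (Metric.closedBall p (dist a p)) :=
    isCompact_iff_compactSpace.1 (isCompact_closedBall _ _)
  obtain ⟨x, hx⟩ := hg.surjective_of_compactSpace ⟨a, by simp⟩
  exact ⟨x, congrArg Subtype.val hx⟩

/-- The derivative of an isometry between real normed spaces preserves the norm. -/
theorem Isometry.norm_fderiv_apply {E F : Type*} [NormedAddCommGroup E] [NormedSpace ℝ E]
    [NormedAddCommGroup F] [NormedSpace ℝ F] {f : E → F} (hf : Isometry f) {L : E →L[ℝ] F} {x : E}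
    (hL : HasFDerivAt f L x) (v : E) : ‖L v‖ = ‖v‖ := by
  have h := (hL.hasLineDerivAt v).tendsto_slope_zero.norm
  refine tendsto_nhds_unique h (tendsto_const_nhds.congr' ?_)
  filter_upwards [self_mem_nhdsWithin] with t ht
  have ht' : t ≠ 0 := ht
  rw [norm_smul, ← dist_eq_norm, hf.dist_eq, dist_eq_norm]
  simp [norm_smul, ht']

/-- A distance preserving map between real normed spaces of the same finite dimension is
surjective. -/
theorem Isometry.surjective_of_finrank_eq {E F : Type*} [NormedAddCommGroup E] [NormedSpace ℝ E]
    [FiniteDimensional ℝ E] [NormedAddCommGroup F] [NormedSpace ℝ F] [FiniteDimensional ℝ F]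
    (h : Module.finrank ℝ E = Module.finrank ℝ F) {f : E → F} (hf : Isometry f) :
    Function.Surjective f := by
  borelize E
  -- Rademacher's theorem.
  obtain ⟨x, hx⟩ := (hf.lipschitz.ae_differentiableAt (μ := MeasureTheory.Measure.addHaar)).exists
  let L : E →ₗᵢ[ℝ] F :=
    ⟨(fderiv ℝ f x : E →ₗ[ℝ] F), hf.norm_fderiv_apply hx.hasFDerivAt⟩
  let e : E ≃ₗᵢ[ℝ] F := L.toLinearIsometryEquiv h
  have : ProperSpace E := FiniteDimensional.proper_real E
  let c : E := e.symm (f 0)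
  have hg : Isometry fun y => e.symm (f y) - c :=
    Isometry.of_dist_eq fun y z => by
      rw [dist_sub_right, e.symm.dist_map, hf.dist_eq]
  intro y
  obtain ⟨z, hz⟩ := hg.surjective_of_fixedPoint (p := 0) (by simp [c]) (e.symm y - c)
  exact ⟨z, e.symm.injective (sub_left_injective hz)⟩

namespace MetSp

/-! ### Metric spaces on sets and normed spaces among them -/

theorem Isometric.symm {X Y : MetSp.{u}} : Isometric X Y → Isometric Y X := by
  rintro ⟨f, hf, hs⟩
  let e := IsometryEquiv.mk' f (Function.surjInv hs) (Function.surjInv_eq hs) hf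
  exact ⟨e.symm, e.symm.isometry, e.symm.surjective⟩

theorem Isometric.trans {X Y Z : MetSp.{u}} : Isometric X Y → Isometric Y Z → Isometric X Z :=
  fun ⟨f, hf, hs⟩ ⟨g, hg, ht⟩ => ⟨g ∘ f, hg.comp hf, ht.comp hs⟩

theorem Isometric.refl (X : MetSp.{u}) : Isometric X X :=
  ⟨id, isometry_id, Function.surjective_id⟩

/-- The inclusion map of a subspace. -/
def IsSubspace.inclusion {X Y : MetSp.{u}} (h : IsSubspace X Y) (x : X.Point) : Y.Point :=
  ⟨x.1, h.choose x.1 x.2⟩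

theorem IsSubspace.isometry_inclusion {X Y : MetSp.{u}} (h : IsSubspace X Y) :
    Isometry h.inclusion :=
  Isometry.of_dist_eq fun x y => h.choose_spec x.1 y.1 x.2 y.2

/-- A subspace that contains all the points is the whole space. -/
theorem IsSubspace.eq_of_forall_mem {X Y : MetSp.{u}} (h : IsSubspace X Y)
    (hY : ∀ z ∈ Y.carrier, z ∈ X.carrier) : X = Y := by
  obtain ⟨c, m⟩ := X
  obtain ⟨d, m'⟩ := Y
  obtain ⟨h, hd⟩ := h
  obtain rfl : c = d := ZFSet.ext fun z => ⟨h z, hY z⟩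
  congr 1
  refine MetricSpace.ext (Dist.ext ?_)
  ext x y
  exact (hd x.1 y.1 x.2 y.2).symm

/-- A member of `normedSpaces n` is isometric to an `n`-dimensional normed space. -/
theorem exists_isometryEquiv_of_mem_normedSpaces {n : ℕ} {X : MetSp.{u}}
    (hX : X ∈ normedSpaces n) :
    ∃ (E : Type (u + 1)) (_ : NormedAddCommGroup E) (_ : NormedSpace ℝ E),
      FiniteDimensional ℝ E ∧ Module.finrank ℝ E = n ∧ Nonempty (E ≃ᵢ X.Point) := by
  obtain ⟨N, S, hd, hr⟩ := hX
  -- The identity map, between the norm metric and the given metric on the same points.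
  refine ⟨X.Point, N, S, Module.finite_of_rank_eq_nat hr, Module.finrank_eq_of_rank_eq hr,
    ⟨@IsometryEquiv.mk X.Point X.Point N.toPseudoMetricSpace.toPseudoEMetricSpace
      X.metric.toPseudoMetricSpace.toPseudoEMetricSpace (Equiv.refl _) ?_⟩⟩
  refine @Isometry.of_dist_eq _ _ N.toPseudoMetricSpace X.metric.toPseudoMetricSpace _ ?_
  intro x y
  exact (hd x y).trans (@dist_eq_norm _ N.toSeminormedAddCommGroup x y).symm

theorem surjective_of_isometry {n : ℕ} {X Y : MetSp.{u}} (hX : X ∈ normedSpaces n)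
    (hY : Y ∈ normedSpaces n) {f : X.Point → Y.Point} (hf : Isometry f) :
    Function.Surjective f := by
  obtain ⟨E, _, _, _, hE, ⟨e⟩⟩ := exists_isometryEquiv_of_mem_normedSpaces hX
  obtain ⟨F, _, _, _, hF, ⟨e'⟩⟩ := exists_isometryEquiv_of_mem_normedSpaces hY
  have h := Isometry.surjective_of_finrank_eq (hE.trans hF.symm)
    (e'.symm.isometry.comp (hf.comp e.isometry))
  intro y
  obtain ⟨x, hx⟩ := h (e'.symm y)
  exact ⟨e x, e'.symm.injective hx⟩

theorem preconnectedSpace_point {n : ℕ} {X : MetSp.{u}} (hX : X ∈ normedSpaces n) :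
    PreconnectedSpace X.Point := by
  obtain ⟨E, _, _, _, -, ⟨e⟩⟩ := exists_isometryEquiv_of_mem_normedSpaces hX
  exact ⟨e.range_eq_univ ▸ isPreconnected_range e.continuous⟩

theorem nonempty_point {n : ℕ} {X : MetSp.{u}} (hX : X ∈ normedSpaces n) : Nonempty X.Point := by
  obtain ⟨E, _, _, _, -, ⟨e⟩⟩ := exists_isometryEquiv_of_mem_normedSpaces hX
  exact ⟨e 0⟩

/-- The metric of an `n`-dimensional normed space is given by a norm function on `ℝⁿ`. -/
theorem exists_equiv_dist_eq {n : ℕ} {X : MetSp.{u}} (hX : X ∈ normedSpaces n) :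
    ∃ (p : (Fin n → ℝ) → ℝ) (e : X.Point ≃ (Fin n → ℝ)), ∀ x y, dist x y = p (e x - e y) := by
  obtain ⟨E, _, _, _, hE, ⟨e⟩⟩ := exists_isometryEquiv_of_mem_normedSpaces hX
  let b := (Module.finBasisOfFinrankEq ℝ E hE).equivFun
  refine ⟨fun v => ‖b.symm v‖, e.symm.toEquiv.trans b.toEquiv, fun x y => ?_⟩
  rw [← e.symm.dist_eq, dist_eq_norm]
  simp

theorem isometric_of_dist_eq {V : Type*} [AddCommGroup V] {X Y : MetSp.{u}} {p : V → ℝ}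
    {e : X.Point ≃ V} {e' : Y.Point ≃ V} (h : ∀ x y, dist x y = p (e x - e y))
    (h' : ∀ x y, dist x y = p (e' x - e' y)) : Isometric X Y :=
  ⟨e.trans e'.symm, Isometry.of_dist_eq fun x y => by simp [h, h'], (e.trans e'.symm).surjective⟩

/-! ### Systems of representatives -/

theorem exists_isRepresentativeSystem (n : ℕ) :
    ∃ M : Set MetSp.{u}, IsRepresentativeSystem (normedSpaces n) M := by
  let s : Setoid (normedSpaces.{u} n) :=
    ⟨fun X Y => Isometric X.1 Y.1, fun X => .refl X.1, .symm, .trans⟩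
  refine ⟨Set.range fun q : Quotient s => q.out.1, ?_, fun X hX => ?_⟩
  · rintro _ ⟨q, rfl⟩
    exact q.out.2
  · refine ⟨(Quotient.mk s ⟨X, hX⟩).out.1, ⟨⟨_, rfl⟩, ?_⟩, ?_⟩
    · exact (Quotient.mk_out (s := s) ⟨X, hX⟩).symm
    · rintro _ ⟨⟨q, rfl⟩, hq⟩
      have h : Quotient.mk s ⟨X, hX⟩ = Quotient.mk s q.out := Quotient.sound hq
      rw [h, Quotient.out_eq]

theorem IsRepresentativeSystem.eq_of_isometric {N M : Set MetSp.{u}}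
    (hM : IsRepresentativeSystem N M) {X Y : MetSp.{u}} (hX : X ∈ M) (hY : Y ∈ M)
    (h : Isometric X Y) : X = Y :=
  (hM.2 X (hM.1 hX)).unique ⟨hX, .refl X⟩ ⟨hY, h⟩

theorem IsRepresentativeSystem.eq_of_isometry {n : ℕ} {M : Set MetSp.{u}}
    (hM : IsRepresentativeSystem (normedSpaces n) M) {X Y : MetSp.{u}} (hX : X ∈ M) (hY : Y ∈ M)
    {f : X.Point → Y.Point} (hf : Isometry f) : X = Y :=
  hM.eq_of_isometric hX hY ⟨f, hf, surjective_of_isometry (hM.1 hX) (hM.1 hY) hf⟩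

/-- A norm function on `Fin n → ℝ` determines the space up to isometry, and such functions form a
set. -/
theorem IsRepresentativeSystem.small {n : ℕ} {M : Set MetSp.{u}}
    (hM : IsRepresentativeSystem (normedSpaces n) M) : Small.{u} M := by
  choose p e h using fun Y : M => exists_equiv_dist_eq (hM.1 Y.2)
  refine small_of_injective (f := p) fun X Y hXY => Subtype.ext ?_
  exact hM.eq_of_isometric X.2 Y.2 (isometric_of_dist_eq (h X) (hXY ▸ h Y))

theorem IsRepresentativeSystem.isMinimalUniversalClass {n : ℕ} {M : Set MetSp.{u}}
    (hM : IsRepresentativeSystem (normedSpaces n) M) :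
    IsMinimalUniversalClass (normedSpaces n) M where
  universal X hX := by
    obtain ⟨Y, ⟨hY, f, hf, -⟩, -⟩ := hM.2 X hX
    exact ⟨Y, hY, f, hf⟩
  minimal B hB hBM X hX := by
    obtain ⟨Y, hY, f, hf⟩ := hB X (hM.1 hX)
    obtain ⟨Z, hZ, hYZ⟩ := hBM Y hY
    -- The composite `X → Y ⊆ Z` forces `Z = X` and is onto by rigidity, so `Y` is all of `X`.
    have hi := hYZ.isometry_inclusion.comp hf
    obtain rfl := hM.eq_of_isometry hX hZ hi
    have hs := surjective_of_isometry (hM.1 hX) (hM.1 hX) hi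
    obtain rfl : Y = X := hYZ.eq_of_forall_mem fun z hz => by
      obtain ⟨x, hx⟩ := hs ⟨z, hz⟩
      have hxz : (f x).1 = z := congrArg Subtype.val hx
      exact hxz ▸ (f x).2
    exact ⟨Y, hY, fun _ h => h, fun _ _ _ _ => rfl⟩
  incomparable X hX Y hY hne := by
    rintro (⟨f, hf⟩ | ⟨f, hf⟩)
    · exact hne (hM.eq_of_isometry hX hY hf)
    · exact hne (hM.eq_of_isometry hY hX hf).symm

/-! ### The disjoint union -/

/-- Every metric space on a small type is isometric to one on a set. -/
theorem exists_isometryEquiv_point (α : Type*) [MetricSpace α] [Small.{u} α] :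
    ∃ X : MetSp.{u}, Nonempty (X.Point ≃ᵢ α) := by
  -- A well-ordering labels the points by distinct von Neumann ordinals.
  let g : Shrink.{u} α → ZFSet.{u} := fun a => (Ordinal.typein WellOrderingRel a).toZFSet
  have hg : Function.Injective g :=
    Ordinal.toZFSet_injective.comp (Ordinal.typein_injective WellOrderingRel)
  let e : {x // x ∈ ZFSet.range g} ≃ α :=
    ((Equiv.ofInjective g hg).trans (Equiv.subtypeEquivRight fun x => by simp)).symm.trans
      (equivShrink α).symm
  exact ⟨⟨ZFSet.range g, .induced e e.injective inferInstance⟩,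
    ⟨⟨e, Isometry.of_dist_eq fun _ _ => rfl⟩⟩⟩

attribute [local instance] Metric.Sigma.metricSpace

/-- A continuous map from a connected space to a disjoint union of metric spaces at mutual distance
at least one takes values in one of them. -/
theorem exists_eq_sigmaMk_comp {ι : Type*} {E : ι → Type*} [∀ i, MetricSpace (E i)] {α : Type*}
    [TopologicalSpace α] [PreconnectedSpace α] [Nonempty α] {f : α → Σ i, E i}
    (hf : Continuous f) : ∃ (i : ι) (g : α → E i), f = Sigma.mk i ∘ g := by
  have hl : IsLocallyConstant fun a => (f a).1 := by
    rw [IsLocallyConstant.iff_eventually_eq]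
    intro a
    filter_upwards [hf.continuousAt.preimage_mem_nhds (Metric.ball_mem_nhds (f a) one_pos)]
      with b hb
    exact Metric.Sigma.fst_eq_of_dist_lt_one _ _ (Metric.mem_ball.1 hb)
  obtain ⟨a₀⟩ := ‹Nonempty α›
  have h a : (f a).1 = (f a₀).1 := hl.apply_eq_of_preconnectedSpace a a₀
  have hy a : ∃ y, f a = ⟨(f a₀).1, y⟩ := by
    rw [← h a]
    exact ⟨_, rfl⟩
  choose g hg using hy
  exact ⟨_, g, funext hg⟩

theorem IsRepresentativeSystem.exists_isDisjointUnion {n : ℕ} {M : Set MetSp.{u}}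
    (hM : IsRepresentativeSystem (normedSpaces n) M) :
    ∃ X : MetSp.{u}, IsDisjointUnion X (fun Y : M => (Y : MetSp.{u})) ∧
      IsMinimalUniversal (normedSpaces n) X := by
  have : Small.{u} M := hM.small
  have (Y : M) : Small.{u} Y.1.Point := inferInstanceAs (Small.{u} {x // x ∈ Y.1.carrier})
  obtain ⟨X, ⟨e⟩⟩ := exists_isometryEquiv_point.{u} (Σ Y : M, Y.1.Point)
  have hi (Y : M) : Isometry fun y : Y.1.Point => e.symm ⟨Y, y⟩ :=
    e.symm.isometry.comp (Metric.Sigma.isometry_mk (E := fun Y : M => Y.1.Point) Y)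
  refine ⟨X, ⟨fun Y => Set.range fun y : Y.1.Point => e.symm ⟨Y, y⟩, ?_, ?_, ?_, ?_⟩, ?_, ?_⟩
  · intro Y
    have := nonempty_point (hM.1 Y.2)
    exact Set.range_nonempty _
  · intro Y Z hne
    rw [Set.disjoint_left]
    rintro _ ⟨y, rfl⟩ ⟨z, hz⟩
    exact hne (congrArg Sigma.fst (e.symm.injective hz)).symm
  · refine Set.eq_univ_of_forall fun x => Set.mem_iUnion.2 ⟨(e x).1, (e x).2, ?_⟩
    exact e.symm_apply_apply x
  · exact fun Y => ⟨(hi Y).isometryEquivOnRange.symm⟩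
  · intro Y hY
    obtain ⟨Z, ⟨hZ, f, hf, -⟩, -⟩ := hM.2 Y hY
    exact ⟨_, (hi ⟨Z, hZ⟩).comp hf⟩
  · intro X₀ hX₀ hU
    refine hX₀.eq_of_forall_mem fun z hz => ?_
    obtain ⟨⟨Y, y⟩, hy⟩ := e.symm.surjective ⟨z, hz⟩
    obtain ⟨f, hf⟩ := hU Y.1 (hM.1 Y.2)
    have := nonempty_point (hM.1 Y.2)
    have := preconnectedSpace_point (hM.1 Y.2)
    have hF := e.isometry.comp (hX₀.isometry_inclusion.comp hf)
    obtain ⟨Z, g, hg⟩ := exists_eq_sigmaMk_comp hF.continuous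
    have hgi : Isometry g := by
      rw [hg] at hF
      exact Isometry.of_dist_eq fun a b =>
        (Metric.Sigma.dist_same (E := fun Y : M => Y.1.Point) Z _ _).symm.trans (hF.dist_eq a b)
    -- Rigidity: the copy of `Y` inside `X₀` covers the whole summand `Y`, in particular the chosen
    -- point.
    obtain rfl : Y = Z := Subtype.ext (hM.eq_of_isometry Y.2 Z.2 hgi)
    obtain ⟨x, rfl⟩ := surjective_of_isometry (hM.1 Y.2) (hM.1 Y.2) hgi y
    have hx := congrArg e.symm (congrFun hg x)
    simp only [Function.comp_apply, e.symm_apply_apply, hy] at hx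
    have hxz : (f x).1 = z := congrArg Subtype.val hx
    exact hxz ▸ (f x).2

end MetSp

theorem propositionp3p26 (n : ℕ) (hn : 0 < n) :
    (∃ M : Set MetSp.{u}, MetSp.IsRepresentativeSystem (MetSp.normedSpaces n) M) ∧
    ∀ M : Set MetSp.{u}, MetSp.IsRepresentativeSystem (MetSp.normedSpaces n) M →
      Small.{u} M ∧
      MetSp.IsMinimalUniversalClass (MetSp.normedSpaces n) M ∧
      ∃ X : MetSp.{u},
        MetSp.IsDisjointUnion X (fun Y : M => (Y : MetSp.{u})) ∧
        MetSp.IsMinimalUniversal (MetSp.normedSpaces n) X :=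
  ⟨MetSp.exists_isRepresentativeSystem n, fun _ hM =>
    ⟨hM.small, hM.isMinimalUniversalClass, hM.exists_isDisjointUnion⟩⟩
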